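/- Let $G$ be a finite abelian group, written additively. For a subset $D\subseteq G$ and an integer $n$, put $D(x)=\sum_{g\in D}x^{g}$ and $D(x^{n})=\sum_{g\in D}x^{ng}$ in the integral group algebra $\mathbb Z[G]$, put $D^{(n)}=\{ng: g\in D\}$, and write $[1]=x^{0}$ and $G(x)=\sum_{g\in G}x^{g}$. The set $D$ is a generalized skew Hadamard difference set (GSHDS) in $G$ if there are a quadratic non-residue $n_0$ (that is, a non-square) in the group $(\mathbb Z/\exp(G)\mathbb Z)^{*}$ and an integer $\lambda$ such that $$D(x)D(x^{n_0})=(k_0-\lambda)[1]+\lambda\,G(x),\qquad D(x)+D(x^{n_0})=G(x)-[1],$$ where $k_0=|D\cap D^{(-n_0)}|$. Proposition. Let $p$ be a prime, let $\alpha\ge 1$ and $s$ be natural numbers, and let $G$ be a finite abelian group with $|G|=p^{2\alpha+1}$ and $\exp(G)=p^{s}$. If $G$ admits a GSHDS, then $2s\le\alpha+1$. -/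

import Mathlib

open scoped BigOperators

namespace GSHDS

noncomputable section

/-- The element `D(x) = ∑_{g ∈ D} x^g` of the integral group algebra `ℤ[G]`. -/
def groupSum {G : Type*} [AddCommGroup G] (D : Finset G) : AddMonoidAlgebra ℤ G :=
  ∑ g ∈ D, AddMonoidAlgebra.single g 1

/-- The element `A(x^n) = ∑_g a_g x^{n g}` attached to `A(x) = ∑_g a_g x^g` and a number `n`. -/
def powSubst {G : Type*} [AddCommGroup G] (n : ℕ) (A : AddMonoidAlgebra ℤ G) :
    AddMonoidAlgebra ℤ G :=
  AddMonoidAlgebra.mapDomain (fun g : G => n • g) A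

open Classical in
/-- The number `k₀ = |D ∩ D^{(-n)}|`, where `D^{(-n)} = {-(n g) : g ∈ D}`. -/
def interCard {G : Type*} [AddCommGroup G] (n : ℕ) (D : Finset G) : ℕ :=
  (D ∩ D.image (fun g => -(n • g))).card

/-- `D` is a generalized skew Hadamard difference set in the finite abelian group `G`: for some
quadratic non-residue `n₀` of `(ℤ / exp(G) ℤ)ˣ` and some integer `lam`,
`D(x) D(x^{n₀}) = (k₀ - lam) [1] + lam G(x)` and `D(x) + D(x^{n₀}) = G(x) - [1]` in `ℤ[G]`,
with `k₀ = |D ∩ D^{(-n₀)}|`. The multiple `n₀ g` depends only on the residue class of `n₀`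
modulo `exp(G)`, so it is computed with the canonical representative. -/
def IsGSHDS {G : Type*} [AddCommGroup G] [Fintype G] (D : Finset G) : Prop :=
  ∃ n₀ : (ZMod (AddMonoid.exponent G))ˣ, ¬ IsSquare n₀ ∧
    (∃ lam : ℤ,
      groupSum D * powSubst (n₀ : ZMod (AddMonoid.exponent G)).val (groupSum D) =
        (((interCard (n₀ : ZMod (AddMonoid.exponent G)).val D : ℕ) : ℤ) - lam) •
            (1 : AddMonoidAlgebra ℤ G) +
          lam • groupSum (Finset.univ : Finset G)) ∧
    groupSum D + powSubst (n₀ : ZMod (AddMonoid.exponent G)).val (groupSum D) =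
      groupSum (Finset.univ : Finset G) - 1

end

end GSHDS

namespace GSHDS

/-! ### Congruences modulo prime powers and periodic sums. -/

section Arithmetic

/-! Replace `D` by the function `f` that is `1` on `D`, `-1` on the other nonzero elements and `0`
at `0`. Its nontrivial character values are square roots of one integer `Δ` divisible by `|G|`, and
multiplication by `n₀` negates `f` (`IsGSHDS.exists_skewSign`, `SkewSign.smul_eq_neg`). A multiplier
`t ≡ 1 (mod p)` is a square, so Galois conjugation fixes the character values and `f(tg) = f(g)`
(`SkewSign.smul_of_modEq_one`).

Let the exponent be `p^(s+1)` and let `x = p^s g`, `z = p^s y` be independent of order `p`. Summing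
`f` over `x + ky` by Poisson summation, and using `|G| ∣ Δ` with multiplier invariance on the dual
side, gives a sum divisible by `p` when `α ≤ 2s` (`SkewSign.dvd_sum`). Multiplier invariance on `G`
reduces that sum modulo `p` to the `p` signs `f(x + jz)` (`SkewSign.dvd_sum_sub_sum`), which must
then all agree. Hence `f(x) = f(x + z) = f(z)`, and likewise `-f(x) = f(nx) = f(nx + z) = f(z)`,
which is absurd; so `2s < α`. A suitable `y` exists because otherwise translation by `x` would
preserve `f` too often for its nonpositive autocorrelation
(`SkewSign.exists_smul_notMem_zmultiples`). -/

lemma exists_modEq_mul_add {p s b : ℕ} (hp : p.Prime) (hb : ¬ p ∣ b) :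
    ∃ t, t ≡ 1 [MOD p] ∧ t * b ≡ b + p [MOD p ^ s] := by
  have hc : Nat.Coprime b (p ^ s) := ((hp.coprime_iff_not_dvd.2 hb).symm).pow_right s
  obtain ⟨m, -, hm⟩ := Nat.exists_mul_mod_eq_of_coprime 1 hc (pow_ne_zero _ hp.ne_zero)
  -- Here `m` inverts `b` modulo `p ^ s`.
  refine ⟨1 + p * m, by simp [Nat.ModEq], ?_⟩
  have h1 : b * m ≡ 1 [MOD p ^ s] := hm
  have h2 := (h1.mul_left p).add_left b
  rw [mul_one] at h2
  convert h2 using 1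
  ring

/-- Since `t ^ p ^ s ≡ 1` and `p ^ s` is odd, `t ^ ((p ^ s + 1) / 2)` is a square root of `t`. -/
lemma exists_sq_modEq {p s t : ℕ} (hp : p.Prime) (hp2 : p ≠ 2) (ht : t ≡ 1 [MOD p]) :
    ∃ u, u.Coprime p ∧ u * u ≡ t [MOD p ^ s] := by
  have hodd : Odd (p ^ s) := (hp.odd_of_ne_two hp2).pow
  obtain ⟨m, hm⟩ := hodd
  have hcop : t.Coprime p := by
    have := ht.gcd_eq
    simpa [Nat.Coprime, Nat.gcd_comm] using this
  refine ⟨t ^ (m + 1), hcop.pow_left _, ?_⟩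
  have h1 : t ^ (m + 1) * t ^ (m + 1) = t ^ p ^ s * t := by
    rw [hm, ← pow_add, ← pow_succ]; congr 1; omega
  have h2 : t ^ p ^ s ≡ 1 [MOD p ^ s] := by
    have h3 : (p : ℤ) ∣ (t : ℤ) - 1 := by
      have := (Nat.modEq_iff_dvd.1 ht.symm); simpa using this
    have h4 := dvd_sub_pow_of_dvd_sub h3 s
    refine (Nat.modEq_iff_dvd.2 ?_).symm
    push_cast
    rw [one_pow] at h4
    exact (pow_dvd_pow _ (Nat.le_succ s)).trans h4
  rw [h1]
  simpa using h2.mul_right t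

lemma sum_range_mul_of_periodic {M : Type*} [AddCommMonoid M] (w : ℕ → M) (p n : ℕ)
    (hw : ∀ b, w (b + p) = w b) : ∑ b ∈ Finset.range (n * p), w b = n • ∑ b ∈ Finset.range p, w b := by
  have key : ∀ n b, w (n * p + b) = w b := by
    intro n b
    induction n with
    | zero => simp
    | succ n ih => rw [← ih, ← hw (n * p + b)]; congr 1; ring
  induction n with
  | zero => simp
  | succ n ih =>
    rw [Nat.succ_mul, Finset.sum_range_add, ih, succ_nsmul]
    simp [key]

end Arithmetic

/-! ### Fourier inversion and Galois conjugation of character values. -/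

section Fourier

variable {G : Type*} [AddCommGroup G] [Fintype G]

/-- The character value `∑_g f(g) χ(g)`. -/
noncomputable def fourier (f : G → ℤ) (χ : AddChar G ℂ) : ℂ := ∑ g, (f g : ℂ) * χ g

lemma sum_fourier_mul (f : G → ℤ) (g : G) :
    ∑ χ : AddChar G ℂ, fourier f χ * χ (-g) = (Fintype.card G : ℂ) * f g := by
  classical
  simp_rw [fourier, Finset.sum_mul, mul_assoc, ← AddChar.map_add_eq_mul]
  rw [Finset.sum_comm]
  simp_rw [← Finset.mul_sum, AddChar.sum_apply_eq_ite]
  rw [Finset.sum_eq_single g]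
  · simp [mul_comm]
  · intro b _ hb
    rw [if_neg (fun h => hb (add_neg_eq_zero.1 h))]; simp
  · simp

/-- Reindex Fourier inversion by `χ ↦ χ ^ t`, a permutation of the dual group. -/
lemma eq_of_fourier_pow_eq {f : G → ℤ} {t : ℕ} {e : ℤ} (ht : (Fintype.card G).Coprime t)
    (h : ∀ χ : AddChar G ℂ, fourier f χ = e * fourier f (χ ^ t)) (g : G) :
    f (t • g) = e * f g := by
  have hc : (Nat.card (AddChar G ℂ)).Coprime t := by
    rwa [Nat.card_eq_fintype_card, AddChar.card_eq]
  have h1 := sum_fourier_mul f (t • g)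
  have h2 := sum_fourier_mul f g
  rw [← (powCoprime hc).sum_comp] at h2
  have h3 : (Fintype.card G : ℂ) * (f (t • g) : ℂ) = Fintype.card G * (e * f g : ℤ) := by
    push_cast
    rw [← h1, mul_left_comm, ← h2, Finset.mul_sum]
    refine Finset.sum_congr rfl fun χ _ => ?_
    rw [h χ, powCoprime_apply, AddChar.pow_apply, ← AddChar.map_nsmul_eq_pow, smul_neg, mul_assoc]
  have h4 : (Fintype.card G : ℂ) ≠ 0 := by simp
  exact_mod_cast mul_left_cancel₀ h4 h3

omit [Fintype G] in
lemma addChar_pow_eq_of_modEq {q a b : ℕ} (hq : ∀ g : G, q • g = 0)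
    (h : a ≡ b [MOD q]) (χ : AddChar G ℂ) : χ ^ a = χ ^ b := by
  have h1 : χ ^ q = 1 := by
    ext g; rw [AddChar.pow_apply, ← AddChar.map_nsmul_eq_pow, hq]; simp
  exact pow_eq_pow_of_modEq h h1

/-- The automorphism `ζ ↦ ζ ^ u` carries the relation at `χ` to the same relation at `χ ^ u`;
chaining the two gives `e * e = 1`. Concretely, the relation is an integer polynomial vanishing at
`ζ`, and `ζ ^ u` has the same minimal polynomial. -/
lemma fourier_pow_sq {f : G → ℤ} {q u : ℕ} [NeZero q] (hq : ∀ g : G, q • g = 0)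
    (hu : u.Coprime q) {e : ℤ} (χ : AddChar G ℂ) (he : e * e = 1)
    (h : fourier f (χ ^ u) = e * fourier f χ) : fourier f (χ ^ (u * u)) = fourier f χ := by
  have hζ := Complex.isPrimitiveRoot_exp q (NeZero.ne q)
  set ζ := Complex.exp (2 * Real.pi * Complex.I / q)
  have hval : ∀ g, ∃ i, i < q ∧ ζ ^ i = χ g := fun g => by
    refine hζ.eq_pow_of_pow_eq_one ?_
    rw [← AddChar.map_nsmul_eq_pow, hq, AddChar.map_zero_eq_one]
  choose i _ hi using hval
  let P : Polynomial ℤ := ∑ g, Polynomial.C (f g) * Polynomial.X ^ i g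
  have hP : ∀ m : ℕ, Polynomial.aeval (ζ ^ m) P = fourier f (χ ^ m) := by
    intro m
    simp only [P, map_sum, map_mul, map_pow, Polynomial.aeval_X, fourier, AddChar.pow_apply, ← hi]
    refine Finset.sum_congr rfl fun g _ => ?_
    rw [← pow_mul, ← pow_mul, mul_comm m]; simp
  let Q : Polynomial ℤ := P.comp (Polynomial.X ^ u) - Polynomial.C e * P
  have hQ : ∀ m : ℕ, Polynomial.aeval (ζ ^ m) Q = fourier f (χ ^ (m * u)) - e * fourier f (χ ^ m) := by
    intro m
    simp only [Q, map_sub, map_mul, Polynomial.aeval_comp, map_pow, Polynomial.aeval_X, ← pow_mul, hP]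
    simp
  have hQ1 : Polynomial.aeval ζ Q = 0 := by
    have := hQ 1
    rw [pow_one] at this
    rw [this, one_mul, pow_one, h, sub_self]
  have hint : IsIntegral ℤ ζ := hζ.isIntegral (Nat.pos_of_ne_zero (NeZero.ne q))
  have hdvd := minpoly.isIntegrallyClosed_dvd hint hQ1
  rw [hζ.minpoly_eq_pow_coprime hu] at hdvd
  have hQu : Polynomial.aeval (ζ ^ u) Q = 0 := by
    obtain ⟨R, hR⟩ := hdvd
    rw [hR, map_mul, minpoly.aeval, zero_mul]
  rw [hQ u, sub_eq_zero, h] at hQu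
  rw [hQu, ← mul_assoc]
  have : (e : ℂ) * e = 1 := by exact_mod_cast he
  rw [this, one_mul]

end Fourier
end GSHDS

namespace GSHDS

/-! ### Roots of unity, integrality and sums of signs. -/

section Arithmetic

lemma coprime_of_modEq_one {p t : ℕ} (ht : t ≡ 1 [MOD p]) : t.Coprime p := by
  simpa [Nat.Coprime, Nat.gcd_comm] using ht.gcd_eq

lemma eq_of_pow_eq_of_coprime {q n : ℕ} (hq : q ≠ 0) (hqn : q.Coprime n) {z w : ℂ}
    (hz : z ^ q = 1) (hw : w ^ q = 1) (h : z ^ n = w ^ n) : z = w := by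
  have hw0 : w ≠ 0 := by
    rintro rfl
    rw [zero_pow hq] at hw
    exact zero_ne_one hw
  have h1 : (z / w) ^ q = 1 := by rw [div_pow, hz, hw, div_one]
  have h2 : (z / w) ^ n = 1 := by rw [div_pow, h, div_self (pow_ne_zero _ hw0)]
  have h3 := Nat.eq_one_of_dvd_coprimes hqn (orderOf_dvd_of_pow_eq_one h1)
    (orderOf_dvd_of_pow_eq_one h2)
  rw [orderOf_eq_one_iff] at h3
  exact (div_eq_one_iff_eq hw0).1 h3

lemma sum_range_geom_root {q : ℕ} {z : ℂ} (hz : z ^ q = 1) :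
    ∑ k ∈ Finset.range q, z ^ k = if z = 1 then (q : ℂ) else 0 := by
  split_ifs with h
  · simp [h]
  · have := geom_sum_mul z q
    rw [hz, sub_self] at this
    exact (mul_eq_zero.1 this).resolve_right (sub_ne_zero.2 h)

lemma prime_dvd_of_sq_eq_mul {p : ℕ} (hp : p.Prime) {S : ℤ} {B : ℂ} (hB : IsIntegral ℤ B)
    (h : (S : ℂ) ^ 2 = p * B) : (p : ℤ) ∣ S := by
  have hp0 : (p : ℂ) ≠ 0 := by exact_mod_cast hp.ne_zero
  have h1 : B = algebraMap ℚ ℂ ((S : ℚ) ^ 2 / p) := by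
    simp only [map_div₀, map_pow, map_intCast, map_natCast]
    field_simp
    rw [h, mul_comm]
  rw [h1, isIntegral_algebraMap_iff (algebraMap ℚ ℂ).injective,
    IsIntegrallyClosed.isIntegral_iff] at hB
  obtain ⟨z, hz⟩ := hB
  have hp0' : (p : ℚ) ≠ 0 := by exact_mod_cast hp.ne_zero
  have h2 : S ^ 2 = p * z := by
    have : (S : ℚ) ^ 2 = p * z := by
      rw [eq_div_iff hp0'] at hz
      rw [← hz]; simp [mul_comm]
    exact_mod_cast this
  exact (Nat.prime_iff_prime_int.1 hp).dvd_of_dvd_pow ⟨z, h2⟩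

lemma sum_range_mul_ite_dvd {M : Type*} [AddCommMonoid M] (φ : ℕ → M) {p : ℕ} (hp : 0 < p) (N : ℕ) :
    ∑ k ∈ Finset.range (N * p), (if p ∣ k then φ k else 0) = ∑ k ∈ Finset.range N, φ (p * k) := by
  induction N with
  | zero => simp
  | succ N ih =>
    rw [Nat.succ_mul, Finset.sum_range_add, ih, Finset.sum_range_succ]
    congr 1
    rw [Finset.sum_eq_single_of_mem 0 (Finset.mem_range.2 hp)]
    · simp [mul_comm]
    · intro i hi hi0
      rw [if_neg]
      intro hd
      have := (Nat.dvd_add_right (Dvd.intro_left N rfl : p ∣ N * p)).1 hd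
      exact hi0 (Nat.eq_zero_of_dvd_of_lt this (Finset.mem_range.1 hi))

/-- With `N` plus signs the sum is `2N - p`, so `p ∣ N` and `N` is `0` or `p`. -/
lemma eq_of_prime_dvd_sum_of_sign {p : ℕ} (hp : p.Prime) (hp2 : p ≠ 2) (a : ℕ → ℤ)
    (ha : ∀ j, a j = 1 ∨ a j = -1) (h : (p : ℤ) ∣ ∑ j ∈ Finset.range p, a j) :
    ∀ j < p, a j = a 0 := by
  classical
  set N := ((Finset.range p).filter fun j => a j = 1).card with hN
  have hsum : ∑ j ∈ Finset.range p, a j = 2 * N - p := by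
    have h1 : ∀ j ∈ Finset.range p, a j = 2 * (if a j = 1 then 1 else 0) - 1 := by
      intro j _
      rcases ha j with h | h <;> simp [h]
    rw [Finset.sum_congr rfl h1, Finset.sum_sub_distrib, ← Finset.mul_sum, Finset.sum_boole]
    simp [hN]
  rw [hsum] at h
  have h2 : (p : ℤ) ∣ 2 * N := by simpa using h.add (dvd_refl (p : ℤ))
  have h3 : p ∣ 2 * N := by exact_mod_cast h2
  have h4 : p ∣ N := (hp.dvd_mul.1 h3).resolve_left
    fun h5 => hp2 ((Nat.prime_dvd_prime_iff_eq hp Nat.prime_two).1 h5)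
  have hle : N ≤ p := by simpa using Finset.card_filter_le (Finset.range p) fun j => a j = 1
  have hcase : N = 0 ∨ N = p := by
    rcases Nat.eq_zero_or_pos N with h0 | h0
    · exact Or.inl h0
    · exact Or.inr (le_antisymm hle (Nat.le_of_dvd h0 h4))
  rcases hcase with h0 | h0
  · rw [hN, Finset.card_eq_zero, Finset.filter_eq_empty_iff] at h0
    intro j hj
    rw [(ha j).resolve_left (h0 (Finset.mem_range.2 hj)),
      (ha 0).resolve_left (h0 (Finset.mem_range.2 hp.pos))]
  · have h5 : ∀ j ∈ Finset.range p, a j = 1 := by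
      rw [← Finset.card_filter_eq_iff, ← hN, h0, Finset.card_range]
    intro j hj
    rw [h5 j (Finset.mem_range.2 hj), h5 0 (Finset.mem_range.2 hp.pos)]

end Arithmetic

/-! ### Multiplier invariance of skew sign functions. -/

section SkewSign

variable {G : Type*} [AddCommGroup G] [Fintype G]

/-- A `±1`-valued function on the nonzero elements of a group of exponent dividing `p ^ s`, whose
nontrivial character values are square roots of `Δ` and are negated by `χ ↦ χ ^ n`. -/
structure SkewSign (p s n : ℕ) (Δ : ℤ) (f : G → ℤ) : Prop where
  prime : p.Prime
  ne_two : p ≠ 2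
  smul_eq_zero : ∀ g : G, p ^ s • g = 0
  coprime : n.Coprime p
  card_coprime : ∀ t : ℕ, t.Coprime p → (Fintype.card G).Coprime t
  sign : ∀ g : G, g ≠ 0 → f g = 1 ∨ f g = -1
  fourier_sq : ∀ χ : AddChar G ℂ, χ ≠ 1 → fourier f χ ^ 2 = Δ
  fourier_pow : ∀ χ : AddChar G ℂ, fourier f (χ ^ n) = -fourier f χ

namespace SkewSign

variable {p s n : ℕ} {Δ : ℤ} {f : G → ℤ}

lemma addChar_card_coprime (h : SkewSign p s n Δ f) {t : ℕ} (ht : t.Coprime p) :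
    (Nat.card (AddChar G ℂ)).Coprime t := by
  rw [Nat.card_eq_fintype_card, AddChar.card_eq]; exact h.card_coprime t ht

lemma fourier_pow_of_modEq_one (h : SkewSign p s n Δ f) {t : ℕ} (ht : t ≡ 1 [MOD p])
    (χ : AddChar G ℂ) : fourier f (χ ^ t) = fourier f χ := by
  rcases eq_or_ne χ 1 with rfl | hχ
  · rw [one_pow]
  obtain ⟨u, hu, hut⟩ := exists_sq_modEq (s := s) h.prime h.ne_two ht
  rw [← addChar_pow_eq_of_modEq h.smul_eq_zero hut]
  have hχu : χ ^ u ≠ 1 := fun h1 => hχ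
    ((powCoprime (h.addChar_card_coprime hu)).injective (by simp [h1]))
  have hsq : fourier f (χ ^ u) ^ 2 = fourier f χ ^ 2 := by
    rw [h.fourier_sq _ hχ, h.fourier_sq _ hχu]
  have : NeZero (p ^ s) := ⟨pow_ne_zero _ h.prime.ne_zero⟩
  rcases sq_eq_sq_iff_eq_or_eq_neg.1 hsq with h1 | h1
  · exact fourier_pow_sq h.smul_eq_zero (hu.pow_right s) (e := 1) χ (by norm_num) (by simpa using h1)
  · exact fourier_pow_sq h.smul_eq_zero (hu.pow_right s) (e := -1) χ (by norm_num) (by simpa using h1)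

lemma smul_of_modEq_one (h : SkewSign p s n Δ f) {t : ℕ} (ht : t ≡ 1 [MOD p]) (g : G) :
    f (t • g) = f g := by
  have := eq_of_fourier_pow_eq (f := f) (e := 1) (h.card_coprime t (coprime_of_modEq_one ht))
    (fun χ => by simp [h.fourier_pow_of_modEq_one ht]) g
  simpa using this

lemma smul_eq_neg (h : SkewSign p s n Δ f) (g : G) : f (n • g) = -f g := by
  have := eq_of_fourier_pow_eq (f := f) (e := -1) (h.card_coprime n h.coprime)
    (fun χ => by simp [h.fourier_pow]) g
  simpa using this

/-- For `p ∤ k`, a multiplier `t ≡ 1 (mod p)` with `tk ≡ k + p` fixes `x` and moves `x + ky` to `x +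
(k + p)y`. These terms are therefore `p`-periodic in `k` and contribute a multiple of `p`; the terms
with `p ∣ k` form the same sum for `py`. -/
lemma dvd_sum_sub_sum (h : SkewSign p s n Δ f) {x : G} (hx : p • x = 0) (m : ℕ) :
    ∀ y : G, p ^ (m + 1) • y = 0 →
      (p : ℤ) ∣ ∑ k ∈ Finset.range (p ^ (m + 1)), f (x + k • y) -
        ∑ j ∈ Finset.range p, f (x + j • p ^ m • y) := by
  induction m with
  | zero => intro y _; simp
  | succ m ih =>
    intro y hy
    have hper : ∀ b, (if p ∣ b + p then 0 else f (x + (b + p) • y)) =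
        if p ∣ b then 0 else f (x + b • y) := by
      intro b
      simp only [Nat.dvd_add_self_right]
      split_ifs with hb
      · rfl
      · obtain ⟨t, ht, htb⟩ := exists_modEq_mul_add (s := m + 1 + 1) h.prime hb
        rw [← h.smul_of_modEq_one ht (x + b • y), smul_add, smul_smul,
          nsmul_eq_nsmul_of_modEq htb hy, nsmul_eq_nsmul_of_modEq ht hx, one_smul]
    have hsplit : ∑ k ∈ Finset.range (p ^ (m + 1 + 1)), f (x + k • y) =
        p ^ (m + 1) • (∑ b ∈ Finset.range p, if p ∣ b then 0 else f (x + b • y)) +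
        ∑ k ∈ Finset.range (p ^ (m + 1)), f (x + k • p • y) := by
      rw [← sum_range_mul_of_periodic _ p (p ^ (m + 1)) hper, pow_succ]
      have h1 := sum_range_mul_ite_dvd (fun k => f (x + k • y)) h.prime.pos (p ^ (m + 1))
      simp only [smul_smul]
      simp only [mul_comm p] at h1
      rw [← h1, ← Finset.sum_add_distrib]
      refine Finset.sum_congr rfl fun k _ => ?_
      split_ifs <;> simp
    rw [hsplit, add_sub_assoc]
    refine dvd_add ?_ ?_
    · rw [pow_succ, mul_comm, mul_smul, nsmul_eq_mul]
      exact dvd_mul_right _ _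
    · have := ih (p • y) (by rw [smul_smul, ← pow_succ]; exact hy)
      simpa [smul_smul, pow_succ] using this

end SkewSign
end SkewSign
end GSHDS

/-! ### Poisson summation and divisibility by `p`. -/

namespace GSHDS
namespace SkewSign

variable {G : Type*} [AddCommGroup G] [Fintype G] {p s n : ℕ} {Δ : ℤ} {f : G → ℤ}

lemma apply_pow_eq_one (h : SkewSign p s n Δ f) (χ : AddChar G ℂ) (g : G) : χ g ^ p ^ s = 1 := by
  rw [← AddChar.map_nsmul_eq_pow, h.smul_eq_zero, AddChar.map_zero_eq_one]

lemma apply_eq_iff_pow_eq (h : SkewSign p s n Δ f) {t : ℕ} (ht : t.Coprime p) (χ : AddChar G ℂ)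
    (g : G) {z : ℂ} (hz : z ^ p ^ s = 1) : (χ ^ t) g = z ^ t ↔ χ g = z := by
  refine ⟨fun h1 => ?_, fun h1 => by rw [AddChar.pow_apply, h1]⟩
  exact eq_of_pow_eq_of_coprime (pow_ne_zero s h.prime.ne_zero) (ht.pow_right s).symm
    (h.apply_pow_eq_one χ g) hz h1

open Classical in
-- Poisson summation along the multiples of `y`. Characters trivial on both `x` and `y` cancel,
-- because `χ ↦ χ ^ n` permutes them and negates the character value of `f`.
lemma card_mul_sum_eq (h : SkewSign p s n Δ f) (x y : G) :
    (Fintype.card G : ℂ) * ((∑ k ∈ Finset.range (p ^ s), f (x + k • y) : ℤ) : ℂ) =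
      (p : ℂ) ^ s * ∑ χ : AddChar G ℂ,
        if χ y = 1 ∧ χ x ≠ 1 then fourier f χ * χ (-x) else 0 := by
  have hpow : ∀ z : ℂ, z ^ p ^ s = 1 → ((z ^ n = 1) ↔ z = 1) := fun z hz =>
    ⟨fun h1 => eq_of_pow_eq_of_coprime (pow_ne_zero s h.prime.ne_zero) (h.coprime.pow_right s).symm
      hz (one_pow _) (by rw [h1, one_pow]), fun h1 => by rw [h1, one_pow]⟩
  have hzero : ∑ χ : AddChar G ℂ, (if χ y = 1 ∧ χ x = 1 then fourier f χ else 0) = 0 := by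
    have h1 := (powCoprime (h.addChar_card_coprime h.coprime)).sum_comp
      fun χ : AddChar G ℂ => if χ y = 1 ∧ χ x = 1 then fourier f χ else 0
    simp only [powCoprime_apply, AddChar.pow_apply, hpow _ (h.apply_pow_eq_one _ _),
      h.fourier_pow] at h1
    have h2 : ∑ χ : AddChar G ℂ, (if χ y = 1 ∧ χ x = 1 then -fourier f χ else 0) =
        -∑ χ : AddChar G ℂ, (if χ y = 1 ∧ χ x = 1 then fourier f χ else 0) := by
      rw [← Finset.sum_neg_distrib]
      exact Finset.sum_congr rfl fun χ _ => by split_ifs <;> simp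
    rw [h2] at h1
    exact self_eq_neg.1 h1.symm
  have hinner : ∀ χ : AddChar G ℂ,
      ∑ k ∈ Finset.range (p ^ s), fourier f χ * χ (-(x + k • y)) =
        p ^ s * ((if χ y = 1 ∧ χ x ≠ 1 then fourier f χ * χ (-x) else 0) +
          if χ y = 1 ∧ χ x = 1 then fourier f χ else 0) := by
    intro χ
    have h1 : ∀ k ∈ Finset.range (p ^ s), fourier f χ * χ (-(x + k • y)) =
        fourier f χ * χ (-x) * χ (-y) ^ k := fun k _ => by
      rw [neg_add, AddChar.map_add_eq_mul, ← smul_neg, AddChar.map_nsmul_eq_pow, mul_assoc]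
    rw [Finset.sum_congr rfl h1, ← Finset.mul_sum, sum_range_geom_root (h.apply_pow_eq_one χ _)]
    simp only [AddChar.map_neg_eq_inv, inv_eq_one]
    by_cases hy : χ y = 1 <;> by_cases hx : χ x = 1 <;> simp [hy, hx, mul_comm]
  have h2 := fun k : ℕ => sum_fourier_mul f (x + k • y)
  push_cast
  rw [Finset.mul_sum]
  simp_rw [← h2]
  rw [Finset.sum_comm, Finset.sum_congr rfl fun χ _ => hinner χ, ← Finset.mul_sum,
    Finset.sum_add_distrib, hzero, add_zero]

open Classical in
-- Group the characters by `χ g = ζ ^ b`; the condition on `p ^ s • g` says `p ∤ b`. Multiplier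
-- invariance makes the signed count `M b` periodic modulo `p`, and `χ (-(p ^ s • g))` also depends
-- only on `b` modulo `p`, so each residue class occurs `p ^ s` times.
lemma exists_isIntegral_sum_eq (h : SkewSign p (s + 1) n Δ f) {F₀ : ℂ} (hF₀ : F₀ ^ 2 = Δ) (g y : G) :
    ∃ A : ℂ, IsIntegral ℤ A ∧
      (∑ χ : AddChar G ℂ, if χ y = 1 ∧ χ (p ^ s • g) ≠ 1 then
        fourier f χ * χ (-(p ^ s • g)) else 0) = F₀ * ((p : ℂ) ^ s * A) := by
  have hq0 : p ^ (s + 1) ≠ 0 := pow_ne_zero _ h.prime.ne_zero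
  have hζ := Complex.isPrimitiveRoot_exp _ hq0
  have : NeZero (p ^ (s + 1)) := ⟨hq0⟩
  set ζ := Complex.exp (2 * Real.pi * Complex.I / (p ^ (s + 1) : ℕ))
  have hζint : IsIntegral ℤ ζ := hζ.isIntegral (Nat.pos_of_ne_zero hq0)
  have hζq : ∀ b : ℕ, (ζ ^ b) ^ p ^ (s + 1) = 1 := fun b => by
    rw [← pow_mul, mul_comm, pow_mul, hζ.pow_eq_one, one_pow]
  -- The value at the trivial character is immaterial: that character has `b = 0`, which is excluded
  -- below.
  let ε : AddChar G ℂ → ℤ := fun χ => if fourier f χ = F₀ then 1 else -1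
  have hε : ∀ χ, χ ≠ 1 → fourier f χ = F₀ * ε χ := by
    intro χ hχ
    have h1 : fourier f χ ^ 2 = F₀ ^ 2 := by rw [hF₀, h.fourier_sq χ hχ]
    by_cases h2 : fourier f χ = F₀
    · simp [ε, h2]
    · have h3 := (sq_eq_sq_iff_eq_or_eq_neg.1 h1).resolve_left h2
      have : ε χ = -1 := if_neg h2
      rw [this, h3]; simp
  let M : ℕ → ℤ := fun b => ∑ χ : AddChar G ℂ, if χ g = ζ ^ b ∧ χ y = 1 then ε χ else 0
  -- A natural number congruent to `-p ^ s` modulo `p ^ (s + 1)`.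
  let e : ℕ := (p ^ (s + 1) - 1) * p ^ s
  let W : ℕ → ℂ := fun b => if p ∣ b then 0 else M b * ζ ^ (b * e)
  have hM : ∀ b, ¬ p ∣ b → M (b + p) = M b := by
    intro b hb
    obtain ⟨t, ht, htb⟩ := exists_modEq_mul_add (s := s + 1) h.prime hb
    have htp := coprime_of_modEq_one ht
    have h1 := (powCoprime (h.addChar_card_coprime htp)).sum_comp
      fun χ : AddChar G ℂ => if χ g = ζ ^ (b + p) ∧ χ y = 1 then ε χ else 0
    change _ = M (b + p) at h1
    rw [← h1]
    refine Finset.sum_congr rfl fun χ _ => ?_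
    have h2 : ζ ^ (b + p) = (ζ ^ b) ^ t := by
      rw [← pow_mul, mul_comm b]
      exact pow_eq_pow_of_modEq htb.symm hζ.pow_eq_one
    have h3 : (χ ^ t) y = 1 ↔ χ y = 1 := by
      simpa using h.apply_eq_iff_pow_eq htp χ y (one_pow (p ^ (s + 1)))
    have h4 : ε (χ ^ t) = ε χ := by simp only [ε, h.fourier_pow_of_modEq_one ht]
    simp only [powCoprime_apply, h2, h.apply_eq_iff_pow_eq htp χ g (hζq b), h3, h4]
  have hW : ∀ b, W (b + p) = W b := by
    intro b
    simp only [W, Nat.dvd_add_self_right]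
    split_ifs with hb
    · rfl
    · rw [hM b hb]
      congr 1
      have h1 : (b + p) * e = b * e + p ^ (s + 1) * (p ^ (s + 1) - 1) := by simp only [e]; ring
      rw [h1, pow_add, pow_mul ζ (p ^ (s + 1)), hζ.pow_eq_one, one_pow, mul_one]
  have hterm : ∀ χ : AddChar G ℂ,
      (if χ y = 1 ∧ χ (p ^ s • g) ≠ 1 then fourier f χ * χ (-(p ^ s • g)) else 0) =
        F₀ * ∑ b ∈ Finset.range (p ^ (s + 1)),
          if p ∣ b then 0 else ((if χ g = ζ ^ b ∧ χ y = 1 then ε χ else 0 : ℤ) : ℂ) * ζ ^ (b * e) := by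
    intro χ
    obtain ⟨i, hi, hχi⟩ := hζ.eq_pow_of_pow_eq_one (h.apply_pow_eq_one χ g)
    rw [Finset.sum_eq_single_of_mem i (Finset.mem_range.2 hi)]
    · have h1 : χ (p ^ s • g) = 1 ↔ p ∣ i := by
        rw [AddChar.map_nsmul_eq_pow, ← hχi, ← pow_mul, hζ.pow_eq_one_iff_dvd, mul_comm, pow_succ]
        exact Nat.mul_dvd_mul_iff_left (pow_pos h.prime.pos s)
      have h2 : χ (-(p ^ s • g)) = ζ ^ (i * e) := by
        rw [pow_mul, hχi, ← AddChar.map_nsmul_eq_pow]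
        congr 1
        rw [neg_eq_iff_add_eq_zero, ← add_smul]
        have : p ^ s + e = p ^ s * p ^ (s + 1) := by
          obtain ⟨q, hq⟩ := Nat.exists_eq_succ_of_ne_zero hq0
          simp only [e, hq, Nat.succ_sub_one]; simp; ring
        rw [this, mul_smul, h.smul_eq_zero, smul_zero]
      by_cases hy : χ y = 1 <;> by_cases hx : p ∣ i
      · simp [hy, h1, hx]
      · have hχ1 : χ ≠ 1 := by
          rintro rfl
          exact hx (h1.1 (by simp))
        simp [hy, h1, hx, h2, hχi, hε χ hχ1, mul_assoc]
      · simp [hy]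
      · simp [hy]
    · intro b hb hbi
      have : χ g ≠ ζ ^ b := fun h1 =>
        hbi (hζ.pow_inj (Finset.mem_range.1 hb) hi (by rw [← h1, hχi]))
      simp [this]
  refine ⟨∑ b ∈ Finset.range p, W b, IsIntegral.sum _ fun b _ => ?_, ?_⟩
  · simp only [W]
    split_ifs
    · exact isIntegral_zero
    · exact (isIntegral_algebraMap (x := M b)).mul (hζint.pow _)
  · have h1 := sum_range_mul_of_periodic W p (p ^ s) hW
    rw [nsmul_eq_mul, ← pow_succ] at h1
    push_cast at h1
    rw [← h1, Finset.sum_congr rfl fun χ _ => hterm χ, ← Finset.mul_sum, Finset.sum_comm]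
    congr 1
    refine Finset.sum_congr rfl fun b _ => ?_
    simp only [W, M]
    split_ifs
    · simp
    · push_cast
      rw [Finset.sum_mul]

/-- Squaring removes `F₀`: with `Δ = |G| m`, the sum `S` satisfies `S² = p · p^(2(2s - α)) · m A²`,
where the odd exponent of `|G|` supplies the spare factor `p`. -/
lemma dvd_sum (h : SkewSign p (s + 1) n Δ f) {α : ℕ} (hcard : Fintype.card G = p ^ (2 * α + 1))
    (hΔ : (Fintype.card G : ℤ) ∣ Δ) (hα : α ≤ 2 * s) (g y : G) :
    (p : ℤ) ∣ ∑ k ∈ Finset.range (p ^ (s + 1)), f (p ^ s • g + k • y) := by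
  obtain ⟨F₀, hF₀⟩ := IsAlgClosed.exists_pow_nat_eq (Δ : ℂ) two_pos
  obtain ⟨m, hm⟩ := hΔ
  obtain ⟨A, hA, hsum⟩ := h.exists_isIntegral_sum_eq hF₀ g y
  have h1 := h.card_mul_sum_eq (p ^ s • g) y
  rw [hsum] at h1
  set S := ∑ k ∈ Finset.range (p ^ (s + 1)), f (p ^ s • g + k • y)
  have hp0 : (p : ℂ) ≠ 0 := by exact_mod_cast h.prime.ne_zero
  obtain ⟨d, hd⟩ := Nat.exists_eq_add_of_le hα
  refine prime_dvd_of_sq_eq_mul h.prime (B := ((p ^ (2 * d) * m : ℤ) : ℂ) * A ^ 2)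
    ((isIntegral_algebraMap (x := (p ^ (2 * d) * m : ℤ))).mul (hA.pow 2)) ?_
  have hv : (Fintype.card G : ℂ) = p ^ (2 * α + 1) := by rw [hcard]; push_cast; rfl
  have hΔ' : F₀ ^ 2 = p ^ (2 * α + 1) * m := by
    rw [hF₀, hm]; push_cast; rw [hv]
  rw [hv] at h1
  have h2 : ((p : ℂ) ^ (2 * α + 1)) ^ 2 * (S : ℂ) ^ 2 =
      (p ^ (2 * α + 1)) ^ 2 * (p * (((p ^ (2 * d) * m : ℤ) : ℂ) * A ^ 2)) := by
    rw [← mul_pow, h1]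
    have : ((p : ℂ) ^ (s + 1) * (F₀ * (p ^ s * A))) ^ 2 = F₀ ^ 2 * (p ^ (2 * (2 * s) + 2) * A ^ 2) := by
      ring
    rw [this, hΔ', hd]
    push_cast
    ring
  exact mul_left_cancel₀ (pow_ne_zero _ (pow_ne_zero _ hp0)) h2

end SkewSign
end GSHDS

/-! ### Autocorrelation, a second independent direction, and the contradiction. -/

namespace GSHDS
namespace SkewSign

variable {G : Type*} [AddCommGroup G] [Fintype G] {p s n : ℕ} {Δ : ℤ} {f : G → ℤ}

lemma apply_zero (h : SkewSign p s n Δ f) : f 0 = 0 := by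
  have := h.smul_eq_neg 0
  rw [smul_zero] at this
  exact self_eq_neg.1 this

/-- The power spectrum is `|Δ|` off the trivial character and `0` there, so the autocorrelation at
`x ≠ 0` is `-|Δ| / |G|`. -/
lemma sum_mul_add_nonpos (h : SkewSign p s n Δ f) {x : G} (hx : x ≠ 0) :
    ∑ g, f g * f (g + x) ≤ 0 := by
  classical
  have h0 : fourier f 1 = 0 := by
    have := h.fourier_pow 1
    rw [one_pow] at this
    exact self_eq_neg.1 this
  have hnorm : ∀ χ : AddChar G ℂ, χ ≠ 1 →
      fourier f χ * (starRingEnd ℂ) (fourier f χ) = (|Δ| : ℤ) := by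
    intro χ hχ
    rw [Complex.mul_conj, Complex.normSq_eq_norm_sq, ← norm_pow, h.fourier_sq χ hχ]
    rw [Complex.norm_intCast, ← Int.cast_abs, Complex.ofReal_intCast]
  have hconj : ∀ χ : AddChar G ℂ, ∑ g, (f g : ℂ) * χ (-g) = (starRingEnd ℂ) (fourier f χ) := by
    intro χ
    simp [fourier, map_sum, AddChar.map_neg_eq_conj]
  have hsum : ∑ χ : AddChar G ℂ, χ (-x) = 0 := by
    rw [AddChar.sum_apply_eq_ite, if_neg (neg_ne_zero.2 hx)]
  have key : (Fintype.card G : ℂ) * ((∑ g, f g * f (g + x) : ℤ) : ℂ) = -(|Δ| : ℤ) := by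
    have h1 : ∀ g, (Fintype.card G : ℂ) * ((f g : ℂ) * f (g + x)) =
        ∑ χ : AddChar G ℂ, fourier f χ * χ (-x) * (f g * χ (-g)) := by
      intro g
      rw [mul_left_comm, ← sum_fourier_mul, Finset.mul_sum]
      refine Finset.sum_congr rfl fun χ _ => ?_
      rw [neg_add, AddChar.map_add_eq_mul]; ring
    push_cast
    rw [Finset.mul_sum, Finset.sum_congr rfl fun g _ => h1 g, Finset.sum_comm]
    simp_rw [← Finset.mul_sum, hconj]
    have h2 : ∀ χ : AddChar G ℂ, fourier f χ * χ (-x) * (starRingEnd ℂ) (fourier f χ) =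
        (|Δ| : ℤ) * χ (-x) - if χ = 1 then ((|Δ| : ℤ) : ℂ) else 0 := by
      intro χ
      split_ifs with hχ
      · subst hχ; simp [h0]
      · rw [mul_right_comm, hnorm χ hχ, sub_zero]
    rw [Finset.sum_congr rfl fun χ _ => h2 χ, Finset.sum_sub_distrib, ← Finset.mul_sum, hsum]
    simp
  have key' : (Fintype.card G : ℤ) * ∑ g, f g * f (g + x) = -|Δ| := by exact_mod_cast key
  have hv : (0 : ℤ) < Fintype.card G := by exact_mod_cast Fintype.card_pos
  by_contra hcon
  have := mul_pos hv (not_le.1 hcon)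
  linarith [abs_nonneg Δ]

lemma abs_le_one (h : SkewSign p s n Δ f) (g : G) : |f g| ≤ 1 := by
  rcases eq_or_ne g 0 with rfl | hg
  · simp [h.apply_zero]
  · rcases h.sign g hg with h1 | h1 <;> simp [h1]

/-- A proper subgroup of a group of odd order has index at least `3`. -/
lemma three_mul_card_torsion_le (h : SkewSign p s n Δ f) {m : ℕ} {g : G} (hg : m • g ≠ 0) :
    3 * Nat.card (nsmulAddMonoidHom (α := G) m).ker ≤ Fintype.card G := by
  set K := (nsmulAddMonoidHom (α := G) m).ker
  have h1 := K.card_mul_index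
  rw [Nat.card_eq_fintype_card (α := G)] at h1
  have h2 : K.index ≠ 1 := fun h2 => by
    rw [AddSubgroup.index_eq_one] at h2
    have : g ∈ K := h2 ▸ AddSubgroup.mem_top g
    exact hg this
  have hodd : ¬ 2 ∣ K.index := fun hd => by
    have hc : (Fintype.card G).Coprime 2 :=
      h.card_coprime 2 ((Nat.coprime_primes Nat.prime_two h.prime).2 h.ne_two.symm)
    have := Nat.Coprime.eq_one_of_dvd hc.symm (hd.trans (Dvd.intro_left _ h1))
    omega
  rw [← h1, mul_comm]
  exact Nat.mul_le_mul_left _ (by omega)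

/-- Otherwise, whenever `p ^ s • y ≠ 0`, the element `x = p ^ s • g` is a multiple of `p ^ s • y`,
so `y + x` is `y` times a multiplier `≡ 1 (mod p)` and `f (y + x) = f y`. With `K` the kernel of `p
^ s`, the autocorrelation at `x` is then at least `|G| - 2|K| ≥ |K| > 0`. -/
lemma exists_smul_notMem_zmultiples (h : SkewSign p (s + 1) n Δ f) (hs : 1 ≤ s) {g : G}
    (hg : p ^ s • g ≠ 0) : ∃ y : G, p ^ s • y ∉ AddSubgroup.zmultiples (p ^ s • g) := by
  classical
  by_contra! hcon
  set x := p ^ s • g with hxdef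
  have hpx : p • x = 0 := by rw [hxdef, smul_smul, ← pow_succ', h.smul_eq_zero]
  have hinv : ∀ y, p ^ s • y ≠ 0 → f (y + x) = f y := by
    intro y hy
    obtain ⟨k, hk⟩ := (mem_zmultiples_iff_mem_range_addOrderOf.1 (hcon y) |>
      Finset.mem_image.1)
    have hk' : k • x = p ^ s • y := hk.2
    have hpk : ¬ p ∣ k := by
      rintro ⟨l, rfl⟩
      rw [mul_comm, mul_smul, hpx, smul_zero] at hk'
      exact hy hk'.symm
    obtain ⟨i, -, hi⟩ := Nat.exists_mul_mod_eq_of_coprime 1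
      ((h.prime.coprime_iff_not_dvd.2 hpk).symm) h.prime.ne_zero
    have hix : x = (i * p ^ s) • y := by
      rw [mul_smul, ← hk', smul_smul, nsmul_eq_nsmul_of_modEq (b := 1) _ hpx, one_smul]
      rw [mul_comm]; exact hi
    have : y + x = (1 + i * p ^ s) • y := by rw [add_smul, one_smul, ← hix]
    rw [this]
    refine h.smul_of_modEq_one ?_ y
    have hd : p ∣ i * p ^ s := (dvd_pow_self p (by omega)).mul_left i
    simpa using (Nat.modEq_zero_iff_dvd.2 hd).add_left 1
  have hterm : ∀ y, 1 - (if p ^ s • y = 0 then 2 else 0 : ℤ) ≤ f y * f (y + x) := by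
    intro y
    split_ifs with hy
    · have h1 : |f y * f (y + x)| ≤ 1 := by
        rw [abs_mul]
        exact mul_le_one₀ (h.abs_le_one _) (abs_nonneg _) (h.abs_le_one _)
      linarith [(abs_le.1 h1).1]
    · have hy0 : y ≠ 0 := by rintro rfl; exact hy (smul_zero _)
      rw [hinv y hy]
      rcases h.sign y hy0 with h1 | h1 <;> simp [h1]
  have hle := (Finset.sum_le_sum fun y _ => hterm y).trans (h.sum_mul_add_nonpos hg)
  have hK : (Finset.univ.filter fun y : G => p ^ s • y = 0).card =
      Nat.card (nsmulAddMonoidHom (α := G) (p ^ s)).ker := by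
    rw [← Fintype.card_subtype, ← Nat.card_eq_fintype_card]
    rfl
  rw [Finset.sum_sub_distrib, ← Finset.sum_filter, Finset.sum_const, Finset.sum_const, hK] at hle
  have h3 := h.three_mul_card_torsion_le hg
  have hpos : 0 < Nat.card (nsmulAddMonoidHom (α := G) (p ^ s)).ker := Nat.card_pos
  simp only [Finset.card_univ, nsmul_eq_mul, mul_one] at hle
  omega

lemma apply_add_smul_eq (h : SkewSign p (s + 1) n Δ f) {α : ℕ}
    (hcard : Fintype.card G = p ^ (2 * α + 1)) (hΔ : (Fintype.card G : ℤ) ∣ Δ) (hα : α ≤ 2 * s)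
    {g y : G} (hgy : ∀ j : ℕ, p ^ s • g + j • p ^ s • y ≠ 0) (j : ℕ) :
    f (p ^ s • g + j • p ^ s • y) = f (p ^ s • g) := by
  have hp : ∀ z : G, p • p ^ s • z = 0 := fun z => by rw [smul_smul, ← pow_succ', h.smul_eq_zero]
  have h1 := (dvd_sub_right (h.dvd_sum hcard hΔ hα g y)).1
    (h.dvd_sum_sub_sum (hp g) s y (h.smul_eq_zero y))
  have h2 := eq_of_prime_dvd_sum_of_sign h.prime h.ne_two
    (fun j => f (p ^ s • g + j • p ^ s • y)) (fun j => h.sign _ (hgy j)) h1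
    (j % p) (Nat.mod_lt _ h.prime.pos)
  simp only [zero_smul, add_zero] at h2
  rw [← h2, nsmul_eq_nsmul_of_modEq (Nat.mod_modEq j p) (hp y)]

theorem lt_of_card_eq (h : SkewSign p (s + 1) n Δ f) {α : ℕ}
    (hcard : Fintype.card G = p ^ (2 * α + 1)) (hΔ : (Fintype.card G : ℤ) ∣ Δ) (hs : 1 ≤ s)
    {g : G} (hg : p ^ s • g ≠ 0) : 2 * s < α := by
  by_contra! hα
  obtain ⟨y, hy⟩ := h.exists_smul_notMem_zmultiples hs hg
  have hp : ∀ z : G, p • p ^ s • z = 0 := fun z => by rw [smul_smul, ← pow_succ', h.smul_eq_zero]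
  have hcop : ∀ (b : ℕ), ¬ p ∣ b → ∃ i : ℕ, ∀ z : G, i • b • p ^ s • z = p ^ s • z := by
    intro b hb
    obtain ⟨i, -, hi⟩ := Nat.exists_mul_mod_eq_of_coprime 1
      ((h.prime.coprime_iff_not_dvd.2 hb).symm) h.prime.ne_zero
    refine ⟨i, fun z => ?_⟩
    rw [smul_smul, nsmul_eq_nsmul_of_modEq (b := 1) (by rw [mul_comm]; exact hi) (hp z), one_smul]
  have hdvd : ∀ b : ℕ, p ∣ b → ∀ z : G, b • p ^ s • z = 0 := by
    rintro _ ⟨l, rfl⟩ z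
    rw [mul_comm, mul_smul, hp, smul_zero]
  have hindep : ∀ a b : ℕ, a • p ^ s • g + b • p ^ s • y = 0 → p ∣ a ∧ p ∣ b := by
    intro a b hab
    have hb : p ∣ b := by
      by_contra hb
      obtain ⟨i, hi⟩ := hcop b hb
      apply hy
      rw [← hi y, eq_neg_of_add_eq_zero_right hab]
      exact AddSubgroup.nsmul_mem _ (neg_mem (AddSubgroup.nsmul_mem _
        (AddSubgroup.mem_zmultiples _) _)) _
    refine ⟨?_, hb⟩
    by_contra ha
    obtain ⟨i, hi⟩ := hcop a ha
    rw [hdvd b hb, add_zero] at hab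
    apply hg
    rw [← hi g, hab, smul_zero]
  have hp1 : ¬ p ∣ 1 := h.prime.one_lt.ne' ∘ Nat.dvd_one.1
  have hpn : ¬ p ∣ n := fun hd => h.prime.one_lt.ne' (Nat.eq_one_of_dvd_coprimes h.coprime hd dvd_rfl)
  have hconst : ∀ a : ℕ, ¬ p ∣ a → f (p ^ s • a • g + 1 • p ^ s • y) = f (p ^ s • a • g) := by
    intro a ha
    refine h.apply_add_smul_eq hcard hΔ hα (fun j hj => ?_) 1
    rw [smul_comm] at hj
    exact ha (hindep a j hj).1
  have hconst' : ∀ a : ℕ, f (p ^ s • y + a • p ^ s • g) = f (p ^ s • y) := by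
    intro a
    refine h.apply_add_smul_eq hcard hΔ hα (fun j hj => ?_) a
    rw [add_comm, ← one_smul ℕ (p ^ s • y)] at hj
    exact hp1 (hindep j 1 hj).2
  -- The value at `z = p ^ s • y` equals both `f x` and `f (n • x) = -f x`, for `x = p ^ s • g`.
  have h1 := hconst 1 hp1
  have h2 := hconst n hpn
  have h3 := hconst' 1
  have h4 := hconst' n
  rw [smul_comm, h.smul_eq_neg, one_smul, add_comm, h4] at h2
  rw [one_smul, one_smul, add_comm] at h1
  rw [one_smul, h1] at h3
  rcases h.sign _ hg with h5 | h5 <;> rw [h5] at h2 h3 <;> rw [h2] at h3 <;> norm_num at h3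

end SkewSign

/-! ### From a GSHDS to a skew sign function. -/

section CharacterValues

variable {G : Type*} [AddCommGroup G]

/-- Evaluation of an element of `ℤ[G]` at a complex character of `G`. -/
noncomputable def charEval (χ : AddChar G ℂ) : AddMonoidAlgebra ℤ G →ₐ[ℤ] ℂ :=
  AddMonoidAlgebra.lift ℤ ℂ G χ.toMonoidHom

lemma charEval_groupSum (χ : AddChar G ℂ) (D : Finset G) :
    charEval χ (groupSum D) = ∑ g ∈ D, χ g := by
  simp [charEval, groupSum, map_sum]

lemma charEval_powSubst_groupSum (χ : AddChar G ℂ) (n : ℕ) (D : Finset G) :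
    charEval χ (powSubst n (groupSum D)) = ∑ g ∈ D, (χ ^ n) g := by
  have : powSubst n (groupSum D) = ∑ g ∈ D, AddMonoidAlgebra.single (n • g) (1 : ℤ) := by
    simp only [powSubst, groupSum]
    induction D using Finset.cons_induction with
    | empty => simp
    | cons a D ha ih => simp [Finset.sum_cons, AddMonoidAlgebra.mapDomain_add, ih]
  rw [this, map_sum]
  refine Finset.sum_congr rfl fun g _ => ?_
  simp [charEval, AddChar.map_nsmul_eq_pow]

end CharacterValues

theorem IsGSHDS.exists_skewSign {G : Type*} [AddCommGroup G] [Fintype G] {p s m : ℕ}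
    (hp : p.Prime) (hs : s ≠ 0) (hm : m ≠ 0) (hcard : Fintype.card G = p ^ m)
    (hexp : AddMonoid.exponent G = p ^ s) {D : Finset G} (hD : IsGSHDS D) :
    ∃ (n : ℕ) (Δ : ℤ) (f : G → ℤ), SkewSign p s n Δ f ∧ (Fintype.card G : ℤ) ∣ Δ := by
  classical
  obtain ⟨n₀, -, ⟨lam, hmul⟩, hadd⟩ := hD
  have hcop : ((n₀ : ZMod (AddMonoid.exponent G)).val).Coprime p := by
    have h1 := ZMod.val_coe_unit_coprime n₀
    exact h1.coprime_dvd_right (hexp ▸ dvd_pow_self p hs)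
  set n := (n₀ : ZMod (AddMonoid.exponent G)).val
  set c : ℤ := ((interCard n D : ℕ) : ℤ) - lam
  have hcardcop : ∀ t : ℕ, t.Coprime p → (Fintype.card G).Coprime t := fun t ht => by
    rw [hcard]; exact (ht.pow_right m).symm
  have hm' : ∀ χ : AddChar G ℂ, (∑ g ∈ D, χ g) * (∑ g ∈ D, (χ ^ n) g) = c + lam * ∑ g, χ g := by
    intro χ
    have := congrArg (charEval χ) hmul
    simpa [charEval_groupSum, charEval_powSubst_groupSum] using this
  have ha' : ∀ χ : AddChar G ℂ, (∑ g ∈ D, χ g) + (∑ g ∈ D, (χ ^ n) g) = (∑ g, χ g) - 1 := by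
    intro χ
    have := congrArg (charEval χ) hadd
    simpa [charEval_groupSum, charEval_powSubst_groupSum] using this
  have hk : 2 * (D.card : ℤ) = Fintype.card G - 1 := by
    have := ha' 1
    simp at this
    have h2 : (D.card : ℤ) + D.card = Fintype.card G - 1 := by exact_mod_cast this
    linarith
  have hkk : (D.card : ℤ) * D.card = c + lam * Fintype.card G := by
    have := hm' 1
    simp at this
    exact_mod_cast this
  -- The last term makes a nontrivial character value `2 χ(D) + 1`. Since `χ(D)` and `χ ^ n (D)`
  -- have sum `-1` and product `c`, its square is the discriminant `1 - 4 * c`.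
  let f : G → ℤ := fun g => 2 * (if g ∈ D then 1 else 0) - 1 + if g = 0 then 1 else 0
  have hf : ∀ χ : AddChar G ℂ, fourier f χ = 2 * (∑ g ∈ D, χ g) - ∑ g, χ g + 1 := by
    intro χ
    have : ∀ g, (f g : ℂ) * χ g =
        2 * (if g ∈ D then χ g else 0) - χ g + if g = 0 then χ g else 0 := by
      intro g
      simp only [f]
      split_ifs <;> push_cast <;> ring
    rw [fourier, Finset.sum_congr rfl fun g _ => this g, Finset.sum_add_distrib,
      Finset.sum_sub_distrib, ← Finset.mul_sum]
    simp
  have hsum : ∀ χ : AddChar G ℂ, χ ≠ 1 → ∑ g, χ g = 0 := fun χ hχ =>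
    AddChar.sum_eq_zero_iff_ne_zero.2 hχ
  refine ⟨n, 1 - 4 * c, f, ⟨hp, ?_, ?_, hcop, hcardcop, ?_, ?_, ?_⟩, ?_⟩
  · rintro rfl
    have : (2 : ℤ) ∣ Fintype.card G := by
      rw [hcard]; push_cast; exact dvd_pow_self _ hm
    omega
  · intro g
    rw [← hexp, AddMonoid.exponent_nsmul_eq_zero]
  · intro g hg
    by_cases h : g ∈ D <;> simp [f, h, hg]
  · intro χ hχ
    have h1 := hm' χ
    have h2 := ha' χ
    rw [hsum χ hχ] at h1 h2
    rw [hf, hsum χ hχ]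
    have h3 : (∑ g ∈ D, (χ ^ n) g) = -1 - ∑ g ∈ D, χ g := by linear_combination h2
    rw [h3] at h1
    push_cast
    linear_combination -4 * h1
  · intro χ
    have h2 := ha' χ
    rcases eq_or_ne χ 1 with rfl | hχ
    · have : fourier f 1 = 0 := by
        rw [one_pow] at h2
        rw [hf]; linear_combination h2
      simp [this]
    · have hχn : χ ^ n ≠ 1 := fun h1 => hχ ((powCoprime (n := n) (by
        rw [Nat.card_eq_fintype_card, AddChar.card_eq]; exact hcardcop n hcop)).injective
          (by simp [h1]))
      rw [hsum χ hχ] at h2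
      rw [hf, hf, hsum χ hχ, hsum _ hχn]
      linear_combination 2 * h2
  -- Substitute `|D| = (|G| - 1) / 2` into `|D|² = c + lam |G|`.
  · refine ⟨2 - Fintype.card G + 4 * lam, ?_⟩
    linear_combination 4 * hkk - (2 * (D.card : ℤ) + Fintype.card G - 1) * hk

end GSHDS

theorem mainTheorem3 {G : Type*} [AddCommGroup G] [Fintype G] (p α s : ℕ) (hp : p.Prime)
    (hα : 1 ≤ α) (hcard : Fintype.card G = p ^ (2 * α + 1))
    (hexp : AddMonoid.exponent G = p ^ s)
    (hD : ∃ D : Finset G, GSHDS.IsGSHDS D) :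
    2 * s ≤ α + 1 := by
  obtain ⟨D, hD⟩ := hD
  rcases Nat.lt_or_ge s 2 with hs | hs
  -- For exponent at most `p`, the bound is just `1 ≤ α`.
  · omega
  obtain ⟨s, rfl⟩ : ∃ k, s = k + 1 := ⟨s - 1, by omega⟩
  obtain ⟨n, Δ, f, h, hΔ⟩ := hD.exists_skewSign hp (by omega) (by omega) hcard hexp
  obtain ⟨g, hg⟩ := AddMonoid.exists_addOrderOf_eq_exponent
    (AddMonoid.ExponentExists.of_finite (G := G))
  have hg0 : p ^ s • g ≠ 0 := by
    intro h0
    have h1 := addOrderOf_dvd_of_nsmul_eq_zero h0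
    rw [hg, hexp] at h1
    have := (Nat.pow_dvd_pow_iff_le_right hp.one_lt).1 h1
    omega
  have := h.lt_of_card_eq hcard hΔ (by omega) hg0
  omega
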